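/- Let $\{C(n,k) : 1\le k\le n\}_{n\ge 1}$ be a triangular array of complex random variables such that, for each $n$, the variables $C(n,1),\dots,C(n,n)$ are i.i.d. Suppose that there is a constant $\tau$, independent of $n$ and $k$, with $|C(n,k)|\le\tau$ almost surely for all $1\le k\le n$. Suppose further that $\sum_{k=1}^n |C(n,k)|^2$ converges in distribution, as $n\to\infty$, to the infinitely divisible law with subordinator characteristics $(\sigma^2,\Pi_s)$, that is, to a probability measure $\mu$ on $\mathbb R$ with $$\int_{\mathbb R} e^{i\theta x}\,\mu(dx)=\exp\Big(i\theta\sigma^2+\int_{(0,\infty)}(e^{i\theta x}-1)\,\Pi_s(dx)\Big)\qquad\text{for all }\theta\in\mathbb R,$$ where $\sigma^2\ge 0$ and $\Pi_s$ is a measure concentrated on $(0,\infty)$ with $\int_{(0,\infty)}(1\wedge x)\,\Pi_s(dx)<\infty$. Write $M_p(\Pi_s)=\int x^p\,\Pi_s(dx)$. Then $M_p(\Pi_s)<\infty$ for every real $p\ge 1$, $$\lim_{n\to\infty} n\,\mathbf E|C(n,1)|^2=\sigma^2+M_1(\Pi_s),$$ and, for every real $p>1$, $$\lim_{n\to\infty}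 n\,\mathbf E|C(n,1)|^{2p}=M_p(\Pi_s).$$ -/

import Mathlib

open MeasureTheory ProbabilityTheory Filter Topology Set

/-- A subordinator Lévy measure: a measure `Q` on `ℝ` concentrated on `(0, ∞)` with
`∫_{(0,∞)} (1 ∧ x) Q(dx) < ∞`. -/
structure IsSubordinatorLevyMeasure (Q : Measure ℝ) : Prop where
  concentrated : Q (Iic 0) = 0
  lintegral_lt_top : ∫⁻ x in Ioi (0 : ℝ), ENNReal.ofReal (min 1 x) ∂Q < ⊤

/-- The exponent `Ψ_s(θ) = i θ b + ∫_{(0,∞)} (e^{iθx} - 1) Q(dx)`.  The integrand is integrable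
whenever `Q` is a subordinator Lévy measure, being bounded by `max 2 |θ| * (1 ∧ x)`. -/
noncomputable def subordinatorExponent (b : ℝ) (Q : Measure ℝ) (θ : ℝ) : ℂ :=
  Complex.I * θ * b + ∫ x in Ioi (0 : ℝ), (Complex.exp (Complex.I * θ * x) - 1) ∂Q

/-- The law `μ` on `ℝ` is the infinitely divisible law with subordinator characteristics `(b, Q)`:
`b ≥ 0`, `Q` is a subordinator Lévy measure, and
`∫ e^{iθx} μ(dx) = e^{Ψ_s(θ)}` for all real `θ`. -/
structure HasSubordinatorCharacteristics (μ : Measure ℝ) (b : ℝ) (Q : Measure ℝ) : Prop where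
  isProbabilityMeasure : IsProbabilityMeasure μ
  nonneg : 0 ≤ b
  levyMeasure : IsSubordinatorLevyMeasure Q
  charFun_eq : ∀ θ : ℝ, charFun μ θ = Complex.exp (subordinatorExponent b Q θ)

/-- The `p`-th moment `M_p(Q) = ∫ x^p Q(dx)` (used for `Q` concentrated on `(0, ∞)`, where the
real power `x^p` is the usual one). -/
noncomputable def rMoment (p : ℝ) (Q : Measure ℝ) : ℝ := ∫ x, x ^ p ∂Q

/-! Let `ρ n` be the law of `|C(n,1)|²`, carried by `[0, T]` with `T = τ²`. The moment `n
E|C(n,1)|^(2p)` is the integral of `x^(p-1)` against `ν_n = n x ρ_n(dx)`, so it suffices to identify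
the weak limits of `ν_n`. The masses of `ν_n` are bounded (Laplace transform at 1), so every
ultrafilter gives a limit `ν`. Since `n(φ_n - 1)` is the integral of `(e^{iθx} - 1)/x` against `ν_n`
and `φ_n^n` is close to `exp(n(φ_n - 1))`, the limit law has drift `ν{0}` and Lévy measure `x⁻¹ν` on
`(0, ∞)`. Uniqueness of characteristics (`eq_of_exponent_eq`) makes these `σ²` and `Π_s` for every
limit point. The atom at 0 contributes `σ² · 0^(p-1)`, which survives only for `p = 1`. -/

/-! ### Uniqueness of subordinator characteristics. -/

theorem norm_cexp_mul_sub_one_le (θ : ℝ) {x : ℝ} (hx : 0 < x) :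
    ‖Complex.exp (Complex.I * θ * x) - 1‖ ≤ (2 + |θ|) * min 1 x := by
  have h1 : ‖Complex.exp (Complex.I * θ * x) - 1‖ ≤ |θ| * x := by
    have := Real.norm_exp_I_mul_ofReal_sub_one_le (x := θ * x)
    rwa [Complex.ofReal_mul, ← mul_assoc, Real.norm_eq_abs, abs_mul, abs_of_pos hx] at this
  have h2 : ‖Complex.exp (Complex.I * θ * x) - 1‖ ≤ 2 := by
    refine (norm_sub_le _ _).trans ?_
    have : ‖Complex.exp (Complex.I * θ * x)‖ = 1 := by
      rw [mul_assoc, ← Complex.ofReal_mul, mul_comm, Complex.norm_exp_ofReal_mul_I]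
    rw [this, norm_one]; norm_num
  have h0 := abs_nonneg θ
  rcases le_total 1 x with h | h
  · rw [min_eq_left h]; linarith
  · rw [min_eq_right h]; nlinarith

namespace IsSubordinatorLevyMeasure

variable {Q Q' : Measure ℝ}

theorem restrict_Ioi (hQ : IsSubordinatorLevyMeasure Q) : Q.restrict (Ioi 0) = Q := by
  have h : Ioi (0 : ℝ) ∈ ae Q := by rw [mem_ae_iff, compl_Ioi, hQ.concentrated]
  exact Measure.restrict_eq_self_of_ae_mem h

theorem integrableOn_min_one (hQ : IsSubordinatorLevyMeasure Q) :
    IntegrableOn (fun x => min 1 x) (Ioi 0) Q := by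
  refine ⟨by fun_prop, ?_⟩
  rw [hasFiniteIntegral_iff_ofReal]
  · exact hQ.lintegral_lt_top
  · filter_upwards [ae_restrict_mem measurableSet_Ioi] with x hx
    exact le_min zero_le_one (le_of_lt hx)

theorem integrableOn_cexp_sub_one (hQ : IsSubordinatorLevyMeasure Q) (θ : ℝ) :
    IntegrableOn (fun x : ℝ => Complex.exp (Complex.I * θ * x) - 1) (Ioi 0) Q := by
  refine (hQ.integrableOn_min_one.const_mul (2 + |θ|)).mono' (by fun_prop) ?_
  filter_upwards [ae_restrict_mem measurableSet_Ioi] with x hx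
  exact norm_cexp_mul_sub_one_le θ hx

theorem continuous_exponent (hQ : IsSubordinatorLevyMeasure Q) (b : ℝ) :
    Continuous (subordinatorExponent b Q) := by
  refine continuous_iff_continuousAt.2 fun θ₀ => ?_
  unfold subordinatorExponent
  refine ContinuousAt.add (by fun_prop) ?_
  refine continuousAt_of_dominated (bound := fun x => (2 + (|θ₀| + 1)) * min 1 x)
    (Eventually.of_forall fun θ => by fun_prop) ?_
    (hQ.integrableOn_min_one.const_mul _) (ae_of_all _ fun x => by fun_prop)
  filter_upwards [(continuous_abs.tendsto θ₀).eventually_le_const (lt_add_one |θ₀|)] with θ hθ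
  filter_upwards [ae_restrict_mem measurableSet_Ioi] with x hx
  refine (norm_cexp_mul_sub_one_le θ hx).trans ?_
  have : 0 ≤ min 1 x := le_min zero_le_one (le_of_lt hx)
  gcongr

/-- Multiplying a subordinator Lévy measure by `2 - 2 cos (h x)` makes it finite. -/
theorem integrableOn_two_sub_cos (hQ : IsSubordinatorLevyMeasure Q) (h : ℝ) :
    IntegrableOn (fun x : ℝ => 2 - 2 * Real.cos (h * x)) (Ioi 0) Q := by
  have := (((hQ.integrableOn_cexp_sub_one h).re).const_mul (-2 : ℝ))
  refine this.congr (ae_of_all _ fun x => ?_)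
  have : Complex.I * h * x = ((h * x : ℝ) : ℂ) * Complex.I := by push_cast; ring
  simp only [RCLike.re_to_complex, this, Complex.sub_re, Complex.exp_ofReal_mul_I_re,
    Complex.one_re]
  ring

/-- A second difference in `θ` removes the drift and multiplies `e^{iθx}` by `2 - e^{ihx} -
e^{-ihx}`, turning exponents into characteristic functions of finite measures. -/
theorem charFun_withDensity (hQ : IsSubordinatorLevyMeasure Q) (b h θ : ℝ) :
    charFun ((Q.restrict (Ioi 0)).withDensity
        fun x => ENNReal.ofReal (2 - 2 * Real.cos (h * x))) θ =
      2 * subordinatorExponent b Q θ - subordinatorExponent b Q (θ + h)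
        - subordinatorExponent b Q (θ - h) := by
  rw [charFun_apply_real, integral_withDensity_eq_integral_toReal_smul (by fun_prop)
    (ae_of_all _ fun x => ENNReal.ofReal_lt_top)]
  have e : 2 * subordinatorExponent b Q θ - subordinatorExponent b Q (θ + h)
      - subordinatorExponent b Q (θ - h) =
      2 * (∫ x in Ioi (0 : ℝ), (Complex.exp (Complex.I * θ * x) - 1) ∂Q)
      - (∫ x in Ioi (0 : ℝ), (Complex.exp (Complex.I * (θ + h : ℝ) * x) - 1) ∂Q)
      - (∫ x in Ioi (0 : ℝ), (Complex.exp (Complex.I * (θ - h : ℝ) * x) - 1) ∂Q) := by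
    simp only [subordinatorExponent]; push_cast; ring
  have i1 := (hQ.integrableOn_cexp_sub_one θ).const_mul 2
  have i2 : IntegrableOn (fun x : ℝ => 2 * (Complex.exp (Complex.I * θ * x) - 1)
      - (Complex.exp (Complex.I * (θ + h : ℝ) * x) - 1)) (Ioi 0) Q :=
    i1.sub (hQ.integrableOn_cexp_sub_one _)
  rw [e, ← integral_const_mul, ← integral_sub i1 (hQ.integrableOn_cexp_sub_one _),
    ← integral_sub i2 (hQ.integrableOn_cexp_sub_one _)]
  refine integral_congr_ae (ae_of_all _ fun x => ?_)
  have hc : 0 ≤ 2 - 2 * Real.cos (h * x) := by linarith [Real.cos_le_one (h * x)]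
  have e1 : Complex.I * (θ + h : ℝ) * x = θ * x * Complex.I + h * x * Complex.I := by
    push_cast; ring
  have e2 : Complex.I * (θ - h : ℝ) * x = θ * x * Complex.I + -(h * x) * Complex.I := by
    push_cast; ring
  have e3 : Complex.I * θ * x = θ * x * Complex.I := by ring
  simp only [e1, e2, e3, Complex.exp_add, ENNReal.toReal_ofReal hc, Complex.real_smul]
  push_cast
  rw [Complex.two_cos]
  ring

/-- The exponent determines the subordinator characteristics. -/
theorem eq_of_exponent_eq (hQ : IsSubordinatorLevyMeasure Q) (hQ' : IsSubordinatorLevyMeasure Q')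
    {b b' : ℝ} (h : ∀ θ, subordinatorExponent b Q θ = subordinatorExponent b' Q' θ) :
    b = b' ∧ Q = Q' := by
  have hfin : ∀ {R : Measure ℝ}, IsSubordinatorLevyMeasure R → ∀ t : ℝ,
      IsFiniteMeasure ((R.restrict (Ioi 0)).withDensity
        fun x => ENNReal.ofReal (2 - 2 * Real.cos (t * x))) := fun hR t =>
    isFiniteMeasure_withDensity_ofReal (hR.integrableOn_two_sub_cos t).2
  have hw : ∀ t : ℝ, (Q.restrict (Ioi 0)).withDensity
        (fun x => ENNReal.ofReal (2 - 2 * Real.cos (t * x))) =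
      (Q'.restrict (Ioi 0)).withDensity
        (fun x => ENNReal.ofReal (2 - 2 * Real.cos (t * x))) := fun t => by
    have := hfin hQ t
    have := hfin hQ' t
    refine Measure.ext_of_charFun (funext fun θ => ?_)
    rw [hQ.charFun_withDensity b, hQ'.charFun_withDensity b', h, h, h]
  -- The step `h = 1/(k+1)` keeps `h x` in `(0, 1]` on `(0, k+1]`, where `2 - 2 cos (h x)` is
  -- positive and can be divided out.
  have hinv : ∀ (R : Measure ℝ) (k : ℕ), R.restrict (Ioc 0 (k + 1)) =
      (((R.restrict (Ioi 0)).withDensity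
        (fun x => ENNReal.ofReal (2 - 2 * Real.cos ((k + 1 : ℝ)⁻¹ * x)))).restrict
        (Ioc 0 (k + 1))).withDensity
        (fun x => ENNReal.ofReal (2 - 2 * Real.cos ((k + 1 : ℝ)⁻¹ * x)))⁻¹ := fun R k => by
    rw [restrict_withDensity measurableSet_Ioc, Measure.restrict_restrict measurableSet_Ioc,
      inter_eq_self_of_subset_left Ioc_subset_Ioi_self]
    symm
    refine withDensity_inv_same (by fun_prop) ?_ (ae_of_all _ fun x => ENNReal.ofReal_ne_top)
    filter_upwards [ae_restrict_mem measurableSet_Ioc] with x hx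
    rw [Ne, ENNReal.ofReal_eq_zero, not_le]
    have hk : (0 : ℝ) < k + 1 := by positivity
    have h1 : 0 < (k + 1 : ℝ)⁻¹ * x := mul_pos (inv_pos.2 hk) hx.1
    have h2 : (k + 1 : ℝ)⁻¹ * x ≤ 1 := by
      rw [inv_mul_le_iff₀ hk]; linarith [hx.2]
    have := Real.cos_lt_cos_of_nonneg_of_le_pi le_rfl (by linarith [Real.pi_gt_three]) h1
    rw [Real.cos_zero] at this
    linarith
  have hres : Q.restrict (Ioi 0) = Q'.restrict (Ioi 0) := by
    have : Ioi (0 : ℝ) = ⋃ k : ℕ, Ioc (0 : ℝ) (k + 1) := by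
      ext x
      simp only [mem_Ioi, mem_iUnion, mem_Ioc, exists_and_left, iff_self_and]
      exact fun _ => ⟨⌈x⌉₊, (Nat.le_ceil x).trans (by linarith)⟩
    rw [this, Measure.restrict_iUnion_congr]
    intro k
    rw [hinv Q, hinv Q', hw]
  rw [hQ.restrict_Ioi, hQ'.restrict_Ioi] at hres
  subst hres
  refine ⟨?_, rfl⟩
  have := h 1
  simpa [subordinatorExponent] using this

end IsSubordinatorLevyMeasure

/-! ### Continuous logarithms, and powers versus exponentials. -/

/-- Uniqueness of lifts through the covering map `exp`. -/
theorem Continuous.eq_of_cexp_eq {f g : ℝ → ℂ} (hf : Continuous f) (hg : Continuous g)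
    (h : ∀ t, Complex.exp (f t) = Complex.exp (g t)) {t₀ : ℝ} (h0 : f t₀ = g t₀) : f = g :=
  Complex.isCoveringMap_exp.eq_of_comp_eq hf hg (funext fun t => Subtype.ext (h t)) t₀ h0

theorem norm_pow_sub_pow_le_of_norm_le_one {a b : ℂ} (ha : ‖a‖ ≤ 1) (hb : ‖b‖ ≤ 1) (n : ℕ) :
    ‖a ^ n - b ^ n‖ ≤ n * ‖a - b‖ := by
  induction n with
  | zero => simp
  | succ n ih =>
    have e : a ^ (n + 1) - b ^ (n + 1) = a * (a ^ n - b ^ n) + (a - b) * b ^ n := by ring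
    rw [e]
    refine (norm_add_le _ _).trans ?_
    rw [norm_mul, norm_mul, norm_pow]
    have h1 : ‖a‖ * ‖a ^ n - b ^ n‖ ≤ 1 * (n * ‖a - b‖) := by gcongr
    have h2 : ‖a - b‖ * ‖b‖ ^ n ≤ ‖a - b‖ * 1 := by
      gcongr; exact pow_le_one₀ (norm_nonneg _) hb
    push_cast
    linarith

/-- If `n (z n - 1)` stays bounded in the closed unit disc, then `z n ^ n` and
`exp (n (z n - 1))` are asymptotically equal. -/
theorem tendsto_pow_sub_cexp {z : ℕ → ℂ} (hz : ∀ n, ‖z n‖ ≤ 1) {B : ℝ}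
    (hB : ∀ᶠ n : ℕ in atTop, n * ‖z n - 1‖ ≤ B) :
    Tendsto (fun n : ℕ => z n ^ n - Complex.exp (n * (z n - 1))) atTop (𝓝 0) := by
  refine squeeze_zero_norm' (a := fun n : ℕ => B ^ 2 / n) ?_
    (tendsto_const_div_atTop_nhds_zero_nat _)
  filter_upwards [hB, eventually_gt_atTop 0, eventually_ge_atTop ⌈B⌉₊] with n hn hn0 hnB
  have hn0' : (0 : ℝ) < n := by exact_mod_cast hn0
  have hBn : B ≤ n := (Nat.le_ceil B).trans (by exact_mod_cast hnB)
  have hle : ‖z n - 1‖ ≤ B / n := by rw [le_div_iff₀ hn0']; linarith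
  have h1 : ‖z n - 1‖ ≤ 1 := hle.trans ((div_le_one hn0').2 hBn)
  -- Both bases lie in the unit disc, so their `n`-th powers differ by at most `n ‖z n - 1‖² ≤
  -- B²/n`.
  have hexp : ‖Complex.exp (z n - 1)‖ ≤ 1 := by
    rw [Complex.norm_exp, Real.exp_le_one_iff, Complex.sub_re, Complex.one_re, sub_nonpos]
    exact (Complex.re_le_norm _).trans (hz n)
  rw [Complex.exp_nat_mul]
  refine (norm_pow_sub_pow_le_of_norm_le_one (hz n) hexp n).trans ?_
  have h2 := Complex.norm_exp_sub_one_sub_id_le h1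
  have h3 : ‖z n - Complex.exp (z n - 1)‖ ≤ ‖z n - 1‖ ^ 2 := by
    rw [norm_sub_rev]; rwa [sub_sub, add_sub_cancel] at h2
  calc n * ‖z n - Complex.exp (z n - 1)‖ ≤ n * (B / n) ^ 2 := by
        gcongr; exact h3.trans (by gcongr)
    _ = B ^ 2 / n := by field_simp

/-! ### Size-biased measures and their inverses. -/

open scoped ENNReal NNReal BoundedContinuousFunction

/-- `(e^{iθx} - 1) / x`, with the value `iθ` at `x = 0`. -/
noncomputable def expQuotient (θ : ℝ) : ℝ → ℂ :=
  dslope (fun x : ℝ => Complex.exp (Complex.I * θ * x)) 0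

theorem hasDerivAt_cexp_mul_zero (θ : ℝ) :
    HasDerivAt (fun x : ℝ => Complex.exp (Complex.I * θ * x)) (Complex.I * θ) 0 := by
  have h : HasDerivAt (fun x : ℂ => Complex.exp (Complex.I * θ * x)) (Complex.I * θ)
      ((0 : ℝ) : ℂ) := by
    simpa using ((hasDerivAt_id (0 : ℂ)).const_mul (Complex.I * θ)).cexp
  exact h.comp_ofReal

theorem continuous_expQuotient (θ : ℝ) : Continuous (expQuotient θ) := by
  rw [← continuousOn_univ, expQuotient, continuousOn_dslope univ_mem]
  exact ⟨by fun_prop, (hasDerivAt_cexp_mul_zero θ).differentiableAt⟩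

theorem mul_expQuotient (θ x : ℝ) :
    (x : ℂ) * expQuotient θ x = Complex.exp (Complex.I * θ * x) - 1 := by
  have := sub_smul_dslope (fun x : ℝ => Complex.exp (Complex.I * θ * x)) 0 x
  simpa [expQuotient] using this

theorem expQuotient_zero (θ : ℝ) : expQuotient θ 0 = Complex.I * θ := by
  rw [expQuotient, dslope_same, (hasDerivAt_cexp_mul_zero θ).deriv]

theorem norm_expQuotient_le (θ x : ℝ) : ‖expQuotient θ x‖ ≤ |θ| := by
  rcases eq_or_ne x 0 with rfl | hx
  · simp [expQuotient_zero]
  have h : ‖(x : ℂ) * expQuotient θ x‖ ≤ |x| * |θ| := by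
    rw [mul_expQuotient]
    have := Real.norm_exp_I_mul_ofReal_sub_one_le (x := θ * x)
    rwa [Complex.ofReal_mul, ← mul_assoc, Real.norm_eq_abs, abs_mul, mul_comm |θ|] at this
  rw [norm_mul, Complex.norm_real, Real.norm_eq_abs] at h
  exact le_of_mul_le_mul_left h (abs_pos.2 hx)

/-- `expQuotient θ` as a bounded continuous function. -/
noncomputable def expQuotientBCF (θ : ℝ) : ℝ →ᵇ ℂ :=
  BoundedContinuousFunction.ofNormedAddCommGroup (expQuotient θ) (continuous_expQuotient θ) |θ|
    (norm_expQuotient_le θ)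

/-- The measure `n x ρ(dx)` on `[0, T]`. -/
noncomputable def scaledSizeBias (ρ : Measure ℝ) (T : ℝ) (n : ℕ) : Measure ℝ :=
  ((n : ℝ≥0) • ρ.restrict (Icc 0 T)).withDensity fun x => ENNReal.ofReal x

section ScaledSizeBias

variable (ρ : Measure ℝ) (T : ℝ) (n : ℕ)

theorem integral_scaledSizeBias {E : Type*} [NormedAddCommGroup E] [NormedSpace ℝ E]
    (f : ℝ → E) :
    ∫ x, f x ∂(scaledSizeBias ρ T n) = (n : ℝ) • ∫ x in Icc 0 T, x • f x ∂ρ := by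
  rw [scaledSizeBias, integral_withDensity_eq_integral_toReal_smul (by fun_prop)
    (ae_of_all _ fun x => ENNReal.ofReal_lt_top), integral_smul_nnreal_measure]
  refine congrArg _ (setIntegral_congr_fun measurableSet_Icc fun x hx => ?_)
  simp only [ENNReal.toReal_ofReal hx.1]

theorem integrableOn_id_Icc [IsFiniteMeasure ρ] : IntegrableOn (fun x : ℝ => x) (Icc 0 T) ρ :=
  continuousOn_id.integrableOn_compact isCompact_Icc

instance [IsFiniteMeasure ρ] : IsFiniteMeasure (scaledSizeBias ρ T n) :=
  isFiniteMeasure_withDensity_ofReal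
    ((integrableOn_id_Icc ρ T).smul_measure_nnreal (c := (n : ℝ≥0))).2

theorem scaledSizeBias_compl_Icc : scaledSizeBias ρ T n (Icc 0 T)ᶜ = 0 := by
  refine withDensity_absolutelyContinuous _ _ ?_
  simp [Measure.restrict_apply measurableSet_Icc.compl]

theorem scaledSizeBias_real_univ :
    (scaledSizeBias ρ T n).real univ = n * ∫ x in Icc 0 T, x ∂ρ := by
  have := integral_scaledSizeBias ρ T n (fun _ => (1 : ℝ))
  simpa using this

end ScaledSizeBias

/-- The measure `x⁻¹ ν(dx)` on `(0, ∞)`. -/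
noncomputable def invSizeBias (ν : Measure ℝ) : Measure ℝ :=
  (ν.restrict (Ioi 0)).withDensity fun x => ENNReal.ofReal x⁻¹

section InvSizeBias

variable (ν : Measure ℝ)

theorem invSizeBias_restrict_Ioi : (invSizeBias ν).restrict (Ioi 0) = invSizeBias ν := by
  rw [invSizeBias, restrict_withDensity measurableSet_Ioi,
    Measure.restrict_restrict measurableSet_Ioi, inter_self]

theorem integral_mul_invSizeBias {E : Type*} [NormedAddCommGroup E] [NormedSpace ℝ E]
    (f : ℝ → E) : ∫ x, x • f x ∂(invSizeBias ν) = ∫ x in Ioi 0, f x ∂ν := by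
  rw [invSizeBias, integral_withDensity_eq_integral_toReal_smul (by fun_prop)
    (ae_of_all _ fun x => ENNReal.ofReal_lt_top)]
  refine setIntegral_congr_fun measurableSet_Ioi fun x hx => ?_
  have hx' : (0 : ℝ) < x := hx
  simp only [ENNReal.toReal_ofReal (inv_nonneg.2 hx'.le), smul_smul, inv_mul_cancel₀ hx'.ne',
    one_smul]

theorem integrable_mul_invSizeBias {f : ℝ → ℝ} (hf : Integrable f ν) :
    Integrable (fun x => x * f x) (invSizeBias ν) := by
  rw [invSizeBias, integrable_withDensity_iff_integrable_smul' (by fun_prop)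
    (ae_of_all _ fun x => ENNReal.ofReal_lt_top)]
  refine hf.integrableOn.congr_fun (fun x hx => ?_) measurableSet_Ioi
  have hx' : (0 : ℝ) < x := hx
  simp only [ENNReal.toReal_ofReal (inv_nonneg.2 hx'.le), smul_eq_mul]
  rw [← mul_assoc, inv_mul_cancel₀ hx'.ne', one_mul]

theorem isSubordinatorLevyMeasure_invSizeBias [IsFiniteMeasure ν] :
    IsSubordinatorLevyMeasure (invSizeBias ν) where
  concentrated := by
    rw [← invSizeBias_restrict_Ioi, Measure.restrict_apply measurableSet_Iic, Iic_inter_Ioi,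
      Ioc_self, measure_empty]
  lintegral_lt_top := by
    rw [invSizeBias_restrict_Ioi]
    have h := integrable_mul_invSizeBias ν (integrable_const (1 : ℝ))
    refine lt_of_le_of_lt (lintegral_mono fun x => ?_) h.2
    simp only [mul_one, ← ofReal_norm]
    exact ENNReal.ofReal_le_ofReal ((min_le_right _ _).trans (le_abs_self x))

variable {ν}

theorem integral_eq_invSizeBias [IsFiniteMeasure ν] (hν : ν (Iio 0) = 0)
    {E : Type*} [NormedAddCommGroup E] [NormedSpace ℝ E] [CompleteSpace E]
    {f : ℝ → E} (hf : Integrable f ν) :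
    ∫ x, f x ∂ν = ν.real {0} • f 0 + ∫ x, x • f x ∂(invSizeBias ν) := by
  have h0 : ν.restrict (Ici 0) = ν := by
    have h : Ici (0 : ℝ) ∈ ae ν := by rwa [mem_ae_iff, compl_Ici]
    exact Measure.restrict_eq_self_of_ae_mem h
  rw [integral_mul_invSizeBias]
  conv_lhs => rw [← h0]
  rw [← Ioi_union_left, union_comm, setIntegral_union (by simp) measurableSet_Ioi hf.integrableOn
    hf.integrableOn, integral_singleton]

/-- One finite measure encodes both characteristics: as the quotient equals `iθ` at 0, the atom
there is the drift. -/
theorem subordinatorExponent_invSizeBias [IsFiniteMeasure ν] (hν : ν (Iio 0) = 0) (θ : ℝ) :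
    subordinatorExponent (ν.real {0}) (invSizeBias ν) θ = ∫ x, expQuotientBCF θ x ∂ν := by
  rw [integral_eq_invSizeBias hν ((expQuotientBCF θ).integrable ν), subordinatorExponent,
    invSizeBias_restrict_Ioi]
  have : ∀ x, expQuotientBCF θ x = expQuotient θ x := fun _ => rfl
  simp only [this, Complex.real_smul, mul_expQuotient, expQuotient_zero]
  ring

end InvSizeBias

/-! ### Limit points of the size-biased measures. -/

theorem nat_mul_charFun_sub_one {ρ : Measure ℝ} [IsProbabilityMeasure ρ] {T : ℝ}
    (hρ : ∀ᵐ x ∂ρ, x ∈ Icc 0 T) (n : ℕ) (θ : ℝ) :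
    (n : ℂ) * (charFun ρ θ - 1) = ∫ x, expQuotientBCF θ x ∂(scaledSizeBias ρ T n) := by
  have h (x : ℝ) : x • expQuotientBCF θ x = Complex.exp (θ * x * Complex.I) - 1 := by
    rw [Complex.real_smul, show expQuotientBCF θ x = expQuotient θ x from rfl, mul_expQuotient]
    ring_nf
  have hi : Integrable (fun x : ℝ => Complex.exp (θ * x * Complex.I)) ρ := by
    refine Integrable.of_bound (by fun_prop) 1 (ae_of_all _ fun x => ?_)
    rw [← Complex.ofReal_mul, Complex.norm_exp_ofReal_mul_I]
  rw [integral_scaledSizeBias, Measure.restrict_eq_self_of_ae_mem hρ]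
  simp only [h]
  rw [integral_sub hi (integrable_const _), ← charFun_apply_real]
  simp

/-- Any limit point of the measures `n x ρ_n(dx)` determines the subordinator characteristics. -/
theorem exists_tendsto_scaledSizeBias {ρ : ℕ → Measure ℝ} [∀ n, IsProbabilityMeasure (ρ n)]
    {T : ℝ} (hρ : ∀ᶠ n in atTop, ∀ᵐ x ∂(ρ n), x ∈ Icc 0 T) {B : ℝ}
    (hB : ∀ᶠ n : ℕ in atTop, n * ∫ x, x ∂(ρ n) ≤ B) {b : ℝ} {Q : Measure ℝ}
    (hQ : IsSubordinatorLevyMeasure Q)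
    (hlim : ∀ θ, Tendsto (fun n => charFun (ρ n) θ ^ n) atTop
      (𝓝 (Complex.exp (subordinatorExponent b Q θ))))
    (U : Ultrafilter ℕ) (hU : (U : Filter ℕ) ≤ atTop) :
    ∃ ν : FiniteMeasure ℝ, (ν : Measure ℝ) (Icc 0 T)ᶜ = 0 ∧
      b = (ν : Measure ℝ).real {0} ∧ Q = invSizeBias ν ∧
      ∀ f : ℝ →ᵇ ℝ, Tendsto (fun n => ∫ x, f x ∂(scaledSizeBias (ρ n) T n)) U
        (𝓝 (∫ x, f x ∂(ν : Measure ℝ))) := by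
  let ν' : ℕ → FiniteMeasure ℝ := fun n => ⟨scaledSizeBias (ρ n) T n, inferInstance⟩
  have hmass : ∀ᶠ n in atTop, (scaledSizeBias (ρ n) T n).real univ ≤ B := by
    filter_upwards [hρ, hB] with n h1 h2
    rwa [scaledSizeBias_real_univ, Measure.restrict_eq_self_of_ae_mem h1]
  have hmem : {ν : FiniteMeasure ℝ | ν.mass ≤ B.toNNReal ∧ ν (Icc 0 T)ᶜ = 0} ∈ U.map ν' := by
    refine hU ?_
    filter_upwards [hmass] with n hn
    refine ⟨?_, ?_⟩
    · exact NNReal.le_toNNReal_of_coe_le hn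
    · rw [FiniteMeasure.null_iff_toMeasure_null]
      exact scaledSizeBias_compl_Icc _ _ _
  -- Bounded mass on a fixed compact interval gives weak compactness.
  obtain ⟨ν, ⟨-, hν⟩, hle⟩ := (isCompact_setOfPred_finiteMeasure_le_of_isCompact B.toNNReal
    (isCompact_Icc (a := (0 : ℝ)) (b := T))).ultrafilter_le_nhds' _ hmem
  have htend : Tendsto ν' U (𝓝 ν) := hle
  have hν0 : (ν : Measure ℝ) (Icc 0 T)ᶜ = 0 := (FiniteMeasure.null_iff_toMeasure_null _ _).1 hν
  have hneg : (ν : Measure ℝ) (Iio 0) = 0 :=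
    measure_mono_null (fun x (hx : x < 0) (h : x ∈ Icc 0 T) => not_le.2 hx h.1) hν0
  have hQν := isSubordinatorLevyMeasure_invSizeBias (ν : Measure ℝ)
  -- Both sides are the limit along `U` of `charFun (ρ n) θ ^ n`.
  have hexp : ∀ θ, Complex.exp (subordinatorExponent b Q θ) =
      Complex.exp (subordinatorExponent ((ν : Measure ℝ).real {0}) (invSizeBias ν) θ) := by
    intro θ
    have h1 : Tendsto (fun n : ℕ => (n : ℂ) * (charFun (ρ n) θ - 1)) U
        (𝓝 (subordinatorExponent ((ν : Measure ℝ).real {0}) (invSizeBias ν) θ)) := by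
      rw [subordinatorExponent_invSizeBias hneg]
      refine ((FiniteMeasure.tendsto_iff_forall_integral_rclike_tendsto ℂ).1 htend
        (expQuotientBCF θ)).congr' (hU ?_)
      filter_upwards [hρ] with n hn
      exact (nat_mul_charFun_sub_one hn n θ).symm
    have h2 : ∀ᶠ n : ℕ in atTop, n * ‖charFun (ρ n) θ - 1‖ ≤ |θ| * B := by
      filter_upwards [hρ, hmass] with n hn hm
      have : (n : ℝ) * ‖charFun (ρ n) θ - 1‖ = ‖(n : ℂ) * (charFun (ρ n) θ - 1)‖ := by
        rw [norm_mul, Complex.norm_natCast]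
      rw [this, nat_mul_charFun_sub_one hn]
      refine (norm_integral_le_of_norm_le_const
        (ae_of_all _ fun x => norm_expQuotient_le θ x)).trans ?_
      gcongr
    have h3 := tendsto_pow_sub_cexp (fun n => norm_charFun_le_one (μ := ρ n) θ) h2
    have h4 := ((hlim θ).sub h3).mono_left hU
    simp only [sub_sub_cancel, sub_zero] at h4
    exact tendsto_nhds_unique h4 ((Complex.continuous_exp.tendsto _).comp h1)
  have heq := Continuous.eq_of_cexp_eq (hQ.continuous_exponent b) (hQν.continuous_exponent _)
    hexp (t₀ := 0) (by simp [subordinatorExponent])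
  obtain ⟨hb, hQ'⟩ := hQ.eq_of_exponent_eq hQν (congrFun heq)
  exact ⟨ν, hν0, hb, hQ', (FiniteMeasure.tendsto_iff_forall_integral_tendsto).1 htend⟩

/-- Convergence of truncated moments in a null array of laws on `[0, T]` whose convolution powers
converge to the law with subordinator characteristics `(b, Q)`. -/
theorem tendsto_nat_mul_integral_of_tendsto_charFun_pow
    {ρ : ℕ → Measure ℝ} [∀ n, IsProbabilityMeasure (ρ n)]
    {T : ℝ} (hρ : ∀ᶠ n in atTop, ∀ᵐ x ∂(ρ n), x ∈ Icc 0 T) {B : ℝ}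
    (hB : ∀ᶠ n : ℕ in atTop, n * ∫ x, x ∂(ρ n) ≤ B) {b : ℝ} {Q : Measure ℝ}
    (hQ : IsSubordinatorLevyMeasure Q)
    (hlim : ∀ θ, Tendsto (fun n => charFun (ρ n) θ ^ n) atTop
      (𝓝 (Complex.exp (subordinatorExponent b Q θ)))) :
    (∀ᵐ x ∂Q, x ∈ Icc 0 T) ∧ ∀ f : ℝ →ᵇ ℝ, Integrable (fun x => x * f x) Q ∧
      Tendsto (fun n : ℕ => n * ∫ x, x * f x ∂(ρ n)) atTop (𝓝 (b * f 0 + ∫ x, x * f x ∂Q)) := by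
  have key := exists_tendsto_scaledSizeBias hρ hB hQ hlim
  obtain ⟨ν, hν, -, rfl, -⟩ := key (Ultrafilter.of atTop) (Ultrafilter.of_le _)
  refine ⟨?_, fun f => ⟨integrable_mul_invSizeBias _ (f.integrable _), ?_⟩⟩
  · exact withDensity_absolutelyContinuous _ _ (Measure.restrict_le_self.absolutelyContinuous hν)
  -- Limit points along different ultrafilters share `b` and `Q`, hence give the same integral of
  -- `f`.
  · rw [tendsto_iff_ultrafilter]
    intro U hU
    obtain ⟨ν₁, hν₁, hb, hQ₁, htend⟩ := key U hU
    have hneg : (ν₁ : Measure ℝ) (Iio 0) = 0 :=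
      measure_mono_null (fun x (hx : x < 0) (h : x ∈ Icc 0 T) => not_le.2 hx h.1) hν₁
    have h := htend f
    rw [integral_eq_invSizeBias hneg (f.integrable _), ← hb, ← hQ₁] at h
    refine h.congr' (hU ?_)
    filter_upwards [hρ] with n hn
    rw [integral_scaledSizeBias, Measure.restrict_eq_self_of_ae_mem hn]
    rfl

/-! ### Mean bound, test functions and the reduction to row laws. -/

/-- A lower bound on the Laplace transform of a convolution power bounds its mean. -/
theorem nat_mul_integral_le_of_le_integral_exp_pow {ρ : Measure ℝ} [IsProbabilityMeasure ρ] {T : ℝ}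
    (hρ : ∀ᵐ x ∂ρ, x ∈ Icc 0 T) {c : ℝ} (hc : 0 < c) {n : ℕ}
    (h : c ≤ (∫ x, Real.exp (-x) ∂ρ) ^ n) :
    n * ∫ x, x ∂ρ ≤ -(1 + T) * Real.log c := by
  obtain ⟨x₀, hx₀⟩ := hρ.exists
  have hT : 0 < 1 + T := by linarith [hx₀.1.trans hx₀.2]
  have hid : Integrable (fun x : ℝ => x) ρ := by
    refine Integrable.of_bound (by fun_prop) T ?_
    filter_upwards [hρ] with x hx
    rw [Real.norm_eq_abs, abs_of_nonneg hx.1]; exact hx.2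
  -- On `[0, T]`, `e^{-x} ≤ 1/(1+x) = 1 - x/(1+x) ≤ 1 - x/(1+T)`.
  have hle : ∫ x, Real.exp (-x) ∂ρ ≤ 1 - (∫ x, x ∂ρ) / (1 + T) := by
    have e : 1 - (∫ x, x ∂ρ) / (1 + T) = ∫ x, (1 - x / (1 + T)) ∂ρ := by
      rw [integral_sub (integrable_const _) (hid.div_const _), integral_div]; simp
    rw [e]
    refine integral_mono_ae (Integrable.of_bound (by fun_prop) 1 ?_)
      ((integrable_const _).sub (hid.div_const _)) ?_
    · filter_upwards [hρ] with x hx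
      rw [Real.norm_eq_abs, Real.abs_exp, Real.exp_le_one_iff]; linarith [hx.1]
    · filter_upwards [hρ] with x hx
      have hx1 : 0 < 1 + x := by linarith [hx.1]
      calc Real.exp (-x) = (Real.exp x)⁻¹ := Real.exp_neg x
        _ ≤ (1 + x)⁻¹ := by gcongr; linarith [Real.add_one_le_exp x]
        _ = 1 - x / (1 + x) := by field_simp; ring
        _ ≤ 1 - x / (1 + T) := by
            have := div_le_div_of_nonneg_left hx.1 hx1 (by linarith [hx.2] : 1 + x ≤ 1 + T)
            linarith
  have h1 : c ≤ Real.exp (-(n * ∫ x, x ∂ρ) / (1 + T)) := by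
    calc c ≤ (∫ x, Real.exp (-x) ∂ρ) ^ n := h
      _ ≤ (Real.exp (-((∫ x, x ∂ρ) / (1 + T)))) ^ n := by
          gcongr
          refine hle.trans ?_
          linarith [Real.add_one_le_exp (-((∫ x, x ∂ρ) / (1 + T)))]
      _ = Real.exp (-(n * ∫ x, x ∂ρ) / (1 + T)) := by
          rw [← Real.exp_nat_mul]; congr 1; ring
  have h2 := (Real.log_le_iff_le_exp hc).2 h1
  rw [le_div_iff₀ hT] at h2
  linarith

/-- `e^{-|x|}` as a bounded continuous function. -/
noncomputable def expNegAbsBCF : ℝ →ᵇ ℝ :=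
  BoundedContinuousFunction.ofNormedAddCommGroup (fun x => Real.exp (-|x|)) (by fun_prop) 1
    fun x => by rw [Real.norm_eq_abs, Real.abs_exp, Real.exp_le_one_iff]; simp

/-- `(max 0 (min x T)) ^ q` as a bounded continuous function. -/
noncomputable def clampRpowBCF (T : ℝ) {q : ℝ} (hq : 0 ≤ q) : ℝ →ᵇ ℝ :=
  BoundedContinuousFunction.ofNormedAddCommGroup (fun x => (max 0 (min x T)) ^ q)
    (by fun_prop (disch := exact fun _ => Or.inr hq)) (|T| ^ q) fun x => by
      have h0 : 0 ≤ max 0 (min x T) := le_max_left _ _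
      rw [Real.norm_eq_abs, abs_of_nonneg (Real.rpow_nonneg h0 q)]
      exact Real.rpow_le_rpow h0
        (max_le (abs_nonneg T) ((min_le_right _ _).trans (le_abs_self T))) hq

theorem mul_clampRpowBCF {T : ℝ} {q : ℝ} (hq : 0 ≤ q) {x : ℝ} (hx : x ∈ Icc 0 T) :
    x * clampRpowBCF T hq x = x ^ (q + 1) := by
  have : clampRpowBCF T hq x = x ^ q := by
    change (max 0 (min x T)) ^ q = x ^ q
    rw [min_eq_left hx.2, max_eq_right hx.1]
  rw [this, Real.rpow_add_one' hx.1 (by linarith), mul_comm]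

theorem tendsto_charFun_pow_and_integral_exp_pow
    {Ω : ℕ → Type*} [∀ n, MeasurableSpace (Ω n)]
    {P : ∀ n, Measure (Ω n)} [∀ n, IsProbabilityMeasure (P n)]
    {X : ∀ n : ℕ, ℕ → Ω n → ℝ}
    (hmeas : ∀ n k, Measurable (X n k))
    (hnonneg : ∀ n k ω, 0 ≤ X n k ω)
    (hindep : ∀ n, iIndepFun (fun (k : Finset.Icc 1 n) => X n k) (P n))
    (hident : ∀ n, ∀ k ∈ Finset.Icc 1 n, IdentDistrib (X n k) (X n 1) (P n) (P n))
    {μ : Measure ℝ} [IsProbabilityMeasure μ]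
    (hconv : TendstoInDistribution
      (fun (n : ℕ) (ω : Ω n) => ∑ k ∈ Finset.Icc 1 n, X n k ω) atTop (id : ℝ → ℝ) P μ) :
    (∀ θ, Tendsto (fun n => charFun ((P n).map (X n 1)) θ ^ n) atTop (𝓝 (charFun μ θ))) ∧
    Tendsto (fun n => (∫ x, Real.exp (-x) ∂((P n).map (X n 1))) ^ n) atTop
      (𝓝 (∫ x, Real.exp (-|x|) ∂μ)) := by
  have ht := hconv.tendsto
  constructor
  · intro θ
    have h := ProbabilityMeasure.tendsto_iff_tendsto_charFun.1 ht θ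
    simp only [ProbabilityMeasure.coe_mk, Measure.map_id] at h
    refine h.congr fun n => ?_
    rw [iIndepFun.charFun_map_fun_finsetSum_eq_prod (fun k _ => (hmeas n k).aemeasurable)
      (hindep n), Finset.prod_apply, Finset.prod_congr rfl fun k hk => by
        rw [(hident n k hk).map_eq]]
    simp
  -- The absolute value makes the test function bounded on `ℝ`; it disappears on the nonnegative row
  -- sums.
  · have h := ProbabilityMeasure.tendsto_iff_forall_integral_tendsto.1 ht expNegAbsBCF
    simp only [ProbabilityMeasure.coe_mk, Measure.map_id] at h
    refine h.congr fun n => ?_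
    rw [integral_map (by fun_prop) (by fun_prop), integral_map (by fun_prop) (by fun_prop)]
    have e : (fun ω => expNegAbsBCF (∑ k ∈ Finset.Icc 1 n, X n k ω)) =
        fun ω => Real.exp ((-1) * (∑ k : Finset.Icc 1 n, X n k) ω) := by
      funext ω
      rw [Finset.sum_apply, Finset.sum_coe_sort (Finset.Icc 1 n) (fun k => X n k ω), neg_one_mul]
      change Real.exp (-|_|) = _
      rw [abs_of_nonneg (Finset.sum_nonneg fun k _ => hnonneg n k ω)]
    have hm := (hindep n).mgf_sum (t := -1) (fun k => hmeas n k) Finset.univ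
    rw [e]
    refine hm.trans ?_
    have hk (k : Finset.Icc 1 n) : mgf (X n k) (P n) (-1) = mgf (X n 1) (P n) (-1) :=
      congrFun (mgf_congr_identDistrib (hident n k k.2)) _
    simp only [hk, Finset.prod_const, Finset.card_univ, Fintype.card_coe, Nat.card_Icc,
      Nat.add_sub_cancel]
    simp [mgf]

/-! ### The main theorem. -/

theorem mainTheorem9
    {Ω : ℕ → Type*} [∀ n, MeasurableSpace (Ω n)]
    (P : ∀ n, Measure (Ω n)) [∀ n, IsProbabilityMeasure (P n)]
    -- row `n ≥ 1` of the array is `C n 1, …, C n n`; other values of `C` are irrelevant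
    (C : ∀ n : ℕ, ℕ → Ω n → ℂ)
    (hmeas : ∀ n, ∀ k ∈ Finset.Icc 1 n, Measurable (C n k))
    (hindep : ∀ n, iIndepFun (fun (k : Finset.Icc 1 n) => C n k) (P n))
    (hident : ∀ n, ∀ k ∈ Finset.Icc 1 n, IdentDistrib (C n k) (C n 1) (P n) (P n))
    (τ : ℝ) (hbound : ∀ n, ∀ k ∈ Finset.Icc 1 n, ∀ᵐ ω ∂(P n), ‖C n k ω‖ ≤ τ)
    (σ : ℝ) (Q : Measure ℝ) (μ : Measure ℝ) [IsProbabilityMeasure μ]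
    (hμ : HasSubordinatorCharacteristics μ (σ ^ 2) Q)
    (hconv : TendstoInDistribution
      (fun (n : ℕ) (ω : Ω n) => ∑ k ∈ Finset.Icc 1 n, ‖C n k ω‖ ^ 2) atTop (id : ℝ → ℝ) P μ) :
    (Integrable (fun x : ℝ => x ^ (1 : ℝ)) Q ∧
      Tendsto (fun n : ℕ => (n : ℝ) * ∫ ω, ‖C n 1 ω‖ ^ 2 ∂(P n)) atTop
        (𝓝 (σ ^ 2 + rMoment 1 Q))) ∧
    ∀ p : ℝ, 1 < p →
      Integrable (fun x : ℝ => x ^ p) Q ∧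
      Tendsto (fun n : ℕ => (n : ℝ) * ∫ ω, ‖C n 1 ω‖ ^ (2 * p) ∂(P n)) atTop
        (𝓝 (rMoment p Q)) := by
  -- The value 0 off the row makes `X n k` measurable for all indices, so the law of `X n 1` is a
  -- probability measure even for `n = 0`.
  let X : ∀ n : ℕ, ℕ → Ω n → ℝ := fun n k =>
    if k ∈ Finset.Icc 1 n then fun ω => ‖C n k ω‖ ^ 2 else 0
  have hX : ∀ n, ∀ k ∈ Finset.Icc 1 n, X n k = fun ω => ‖C n k ω‖ ^ 2 := fun n k hk => if_pos hk
  have h1mem : ∀ᶠ n : ℕ in atTop, 1 ∈ Finset.Icc 1 n := by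
    filter_upwards [eventually_ge_atTop 1] with n hn
    simpa using hn
  have hXmeas : ∀ n k, Measurable (X n k) := by
    intro n k
    by_cases hk : k ∈ Finset.Icc 1 n
    · rw [hX n k hk]; exact (hmeas n k hk).norm.pow_const 2
    · simp only [X, if_neg hk]; exact measurable_const
  have hXnonneg : ∀ n k ω, 0 ≤ X n k ω := by
    intro n k ω
    by_cases hk : k ∈ Finset.Icc 1 n
    · rw [hX n k hk]; positivity
    · simp only [X, if_neg hk]; exact le_rfl
  have hsq : Measurable fun z : ℂ => ‖z‖ ^ 2 := by fun_prop
  have hXindep : ∀ n, iIndepFun (fun (k : Finset.Icc 1 n) => X n k) (P n) := by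
    intro n
    have := (hindep n).comp (fun _ z => ‖z‖ ^ 2) fun _ => hsq
    convert this using 2 with k
    exact hX n k k.2
  have hXident : ∀ n, ∀ k ∈ Finset.Icc 1 n, IdentDistrib (X n k) (X n 1) (P n) (P n) := by
    intro n k hk
    have h1 : 1 ∈ Finset.Icc 1 n := by
      rw [Finset.mem_Icc] at hk ⊢; omega
    rw [hX n k hk, hX n 1 h1]
    exact (hident n k hk).comp hsq
  have hXconv : TendstoInDistribution
      (fun (n : ℕ) (ω : Ω n) => ∑ k ∈ Finset.Icc 1 n, X n k ω) atTop (id : ℝ → ℝ) P μ := by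
    convert hconv using 3 with n ω
    exact Finset.sum_congr rfl fun k hk => congrFun (hX n k hk) ω
  obtain ⟨hchar, hlap⟩ :=
    tendsto_charFun_pow_and_integral_exp_pow hXmeas hXnonneg hXindep hXident hXconv
  have hprob : ∀ n, IsProbabilityMeasure ((P n).map (X n 1)) := fun n =>
    Measure.isProbabilityMeasure_map (hXmeas n 1).aemeasurable
  have hsupp : ∀ᶠ n in atTop, ∀ᵐ x ∂((P n).map (X n 1)), x ∈ Icc 0 (τ ^ 2) := by
    filter_upwards [h1mem] with n hn
    refine (ae_map_iff (p := (· ∈ Icc 0 (τ ^ 2))) (hXmeas n 1).aemeasurable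
      measurableSet_Icc).2 ?_
    rw [hX n 1 hn]
    filter_upwards [hbound n 1 hn] with ω hω
    exact ⟨by positivity, by gcongr⟩
  have hc : 0 < ∫ x, Real.exp (-|x|) ∂μ := integral_exp_pos (expNegAbsBCF.integrable μ)
  -- The Laplace transforms of the row sums tend to a positive limit, so they eventually exceed half
  -- of it.
  have hB : ∀ᶠ n : ℕ in atTop, n * ∫ x, x ∂((P n).map (X n 1)) ≤
      -(1 + τ ^ 2) * Real.log ((∫ x, Real.exp (-|x|) ∂μ) / 2) := by
    filter_upwards [hsupp, hlap.eventually_const_le (half_lt_self hc)] with n hn h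
    exact nat_mul_integral_le_of_le_integral_exp_pow hn (half_pos hc) h
  obtain ⟨hQ, hf⟩ := tendsto_nat_mul_integral_of_tendsto_charFun_pow hsupp hB hμ.levyMeasure
    fun θ => by rw [← hμ.charFun_eq]; exact hchar θ
  -- Here `q = p - 1`; the convention `0 ^ 0 = 1` covers `p = 1` as well.
  have hmoment : ∀ q : ℝ, ∀ hq : 0 ≤ q, Integrable (fun x : ℝ => x ^ (q + 1)) Q ∧
      Tendsto (fun n : ℕ => (n : ℝ) * ∫ ω, ‖C n 1 ω‖ ^ (2 * (q + 1)) ∂(P n)) atTop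
        (𝓝 (σ ^ 2 * (0 : ℝ) ^ q + rMoment (q + 1) Q)) := by
    intro q hq
    obtain ⟨h1, h2⟩ := hf (clampRpowBCF (τ ^ 2) hq)
    have hae : (fun x => x * clampRpowBCF (τ ^ 2) hq x) =ᵐ[Q] fun x => x ^ (q + 1) := by
      filter_upwards [hQ] with x hx using mul_clampRpowBCF hq hx
    have h0 : clampRpowBCF (τ ^ 2) hq 0 = (0 : ℝ) ^ q := by
      change (max 0 (min 0 (τ ^ 2))) ^ q = _
      rw [min_eq_left (by positivity), max_self]
    rw [integral_congr_ae hae, h0] at h2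
    refine ⟨h1.congr hae, h2.congr' ?_⟩
    filter_upwards [hsupp, h1mem] with n hn hn1
    have e : (fun x => x * clampRpowBCF (τ ^ 2) hq x) =ᵐ[(P n).map (X n 1)]
        fun x => x ^ (q + 1) := by
      filter_upwards [hn] with x hx using mul_clampRpowBCF hq hx
    rw [integral_congr_ae e, integral_map (hXmeas n 1).aemeasurable
      (by fun_prop), hX n 1 hn1]
    congr 2 with ω
    rw [Real.rpow_mul (norm_nonneg _), Real.rpow_two]
  refine ⟨?_, fun p hp => ?_⟩
  · have := hmoment 0 le_rfl
    simpa using this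
  · have := hmoment (p - 1) (by linarith)
    rwa [sub_add_cancel, Real.zero_rpow (by linarith), mul_zero, zero_add] at this
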